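/- Let $m,c,k,\mu,\rho_1,\rho_2>0$ and $0<\alpha<1$, and let $f:[0,\infty)\to\mathbb R$ satisfy $|f(t)|\le F$ for all $t\ge 0$, where the constant $F$ is unknown (it does not enter the control law). Consider the controlled fractional Kelvin–Voigt oscillator $$m\ddot x(t)+c\,D^{\alpha}x(t)+k\,x(t)=f(t)+u(t),\qquad t>0,\qquad x(t)=0\ \text{ for } t\le 0,$$ where $D^\alpha x(t)=\frac1{\Gamma(1-\alpha)}\int_0^t (t-\tau)^{-\alpha}\dot x(\tau)\,d\tau$ is the Caputo derivative, with state variables $x_1=x$, $x_2=D^\alpha x$, $x_3=\dot x$ on $[0,\infty)$ (at $t=0$, $\dot x$ is the right derivative, and its value $\dot x(0^+)$ is arbitrary). Put $$s(t)=x_3(t)+\frac km\int_0^t x_1(\tau)\,d\tau+\frac cm\int_0^t x_2(\tau)\,d\tau .$$ Let the control and the adaptive estimate $\hat F$ of $F$ (with arbitrary initial value $\hat F(0)\in\mathbb R$) be given by $$u(t)=-\Big(\hat F(t)+\frac{\rho_1}{\sqrt2}\Big)\operatorname{sign}(s(t))-\rho_2 s(t),\qquad \dot{\hat F}(t)=\frac{\mu}{m}|s(t)|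 .$$ Solutions are understood as follows: $x_3$ is locally absolutely continuous on $[0,\infty)$, the equation of motion and the control law hold for almost every $t>0$, and $\operatorname{sign}(0)$ may take any value in $[-1,1]$, possibly depending on $t$ (Filippov's convention, which includes $\operatorname{sign}(0)=0$). Then for every such solution the function $\tilde V_2=\frac12\big[s^2+\frac1\mu(\hat F-F)^2\big]$ is differentiable at almost every $t>0$, with $$\dot{\tilde V}_2=\frac1m\Big[f s-\Big(F+\frac{\rho_1}{\sqrt2}\Big)|s|-\rho_2 s^2\Big]\le \frac1m\Big[-\frac{\rho_1}{\sqrt2}|s|-\rho_2 s^2\Big]\le 0 ,$$ $\tilde V_2$ is non-increasing on $[0,\infty)$, and $s(t)\to0$ and $x_1(t)\to0$ as $t\to\infty$. -/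

import Mathlib

open MeasureTheory Set Filter Topology

noncomputable section

/-- The Caputo derivative `ₐD_t^α g (t)` of non-integer order `α > 0`, with `n - 1 < α < n`. -/
def caputoDeriv (a α : ℝ) (g : ℝ → ℝ) (t : ℝ) : ℝ :=
  1 / Real.Gamma (⌈α⌉₊ - α) *
    ∫ τ in a..t, iteratedDeriv ⌈α⌉₊ g τ / (t - τ) ^ (α - ⌈α⌉₊ + 1)

/-- A controlled fractional Kelvin-Voigt oscillator `m x'' + c D^α x + k x = f + u` on `[0, ∞)`,
with state variables `x₁ = x` (displacement), `x₂ = D^α x` and `x₃ = x'` (velocity), and with zero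
prehistory. Since the feedback `u` may be discontinuous, the equation of motion is understood in
the sense of Carathéodory: the velocity is locally absolutely continuous and the equation holds at
almost every time. -/
structure IsKelvinVoigtMotion (m c k α : ℝ) (f u x₁ x₂ x₃ : ℝ → ℝ) : Prop where
  zero_prehistory : ∀ t ≤ 0, x₁ t = 0
  velocity : ∀ t ≥ 0, HasDerivWithinAt x₁ (x₃ t) (Ici 0) t
  fractional : ∀ t ≥ 0, x₂ t = caputoDeriv 0 α x₁ t
  absolutelyContinuous : ∀ T ≥ 0, AbsolutelyContinuousOnInterval x₃ 0 T
  motion : ∀ᵐ t : ℝ, 0 < t →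
    HasDerivAt x₃ (-(k / m) * x₁ t - c / m * x₂ t + f t / m + u t / m) t

/-- The fractional sliding variable
`s(t) = x₃(t) + (k/m) ∫₀ᵗ x₁ dτ + (c/m) ∫₀ᵗ x₂ dτ`. -/
def slidingVariable (m c k : ℝ) (x₁ x₂ x₃ : ℝ → ℝ) (t : ℝ) : ℝ :=
  x₃ t + k / m * (∫ τ in (0 : ℝ)..t, x₁ τ) + c / m * ∫ τ in (0 : ℝ)..t, x₂ τ

/-- The admissible values of `sign r` in a switching law: the usual sign for `r ≠ 0`, and any value
in `[-1, 1]` for `r = 0` (Filippov's convention; it contains the value `sign 0 = 0`). -/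
def signSet (r : ℝ) : Set ℝ :=
  {σ | (0 < r → σ = 1) ∧ (r < 0 → σ = -1) ∧ |σ| ≤ 1}

/-- The adaptive switching law `u = -(Fhat + ρ₁/√2) sign(s) - ρ₂ s`. -/
def IsSwitchingControl (ρ₁ ρ₂ : ℝ) (s Fhat u : ℝ → ℝ) : Prop :=
  ∀ᵐ t : ℝ, 0 < t → ∃ σ ∈ signSet (s t), u t = -(Fhat t + ρ₁ / √2) * σ - ρ₂ * s t

/-- The adaptation law `Fhat' = (μ/m) |s|` on `[0, ∞)`, with arbitrary initial estimate. -/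
def IsAdaptiveEstimate (m μ : ℝ) (s Fhat : ℝ → ℝ) : Prop :=
  ∀ t ≥ 0, HasDerivWithinAt Fhat (μ / m * |s t|) (Ici 0) t

/-- The Lyapunov function `(s² + (Fhat - F)²/μ) / 2`. -/
def adaptiveLyapunov (μ F : ℝ) (s Fhat : ℝ → ℝ) (t : ℝ) : ℝ :=
  1 / 2 * (s t ^ 2 + 1 / μ * (Fhat t - F) ^ 2)

end

/-! The integral terms in s are chosen so that the elastic and fractional forces cancel in its
derivative: s' = (f + u)/m almost everywhere. In the derivative of the Lyapunov function the
adaptation law then replaces `Fhat` by F, and |f| ≤ F fixes the sign. Absolute continuity turns this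
into monotonicity, so s and `Fhat` are bounded. As `Fhat` is also nondecreasing, it converges; this
makes |s| integrable. The control is bounded, so s is Lipschitz, and Barbalat's lemma applied to
`Fhat` gives s → 0.

For the displacement X, put Y = ∫X. The definition of s becomes X' + aY + bJX = s, an oscillator for
Y with a fractional damper, where J is `diffusiveIntegral`. Since t^{-α} is a positive superposition
of exponentials e^{-rt}, JX is a superposition of filters Z with Z' = X - rZ, each of them passive:
∫XZ = Z²/2 + r∫Z². Hence J is positive definite, and the energy balance with s in L¹ bounds X, Y and
the total dissipation (`fractionalOscillator_energy_bound`). Finite dissipation gives one rate r > 0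
with Z in L² (`exists_integral_sq_expFilter_le`). Barbalat's lemma, used on ∫Z² and then on Z,
yields Z → 0 and X - rZ = Z' → 0, so X → 0. -/

/-! ### Convergence at infinity -/

/-- Barbalat's lemma: if `G` converges at infinity and its derivative is Lipschitz on `[0, ∞)`,
then the derivative tends to zero. -/
theorem tendsto_zero_of_tendsto_of_lipschitz_deriv {G g : ℝ → ℝ} {L l : ℝ}
    (hG : ∀ t ≥ 0, HasDerivWithinAt G (g t) (Ici 0) t)
    (hg : ∀ a ≥ 0, ∀ b ≥ 0, |g a - g b| ≤ L * |a - b|)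
    (hl : Tendsto G atTop (𝓝 l)) : Tendsto g atTop (𝓝 0) := by
  have hL : 0 ≤ L := by
    have := hg 0 le_rfl 1 zero_le_one
    have h2 := abs_nonneg (g 0 - g 1)
    norm_num at this
    linarith
  rw [Metric.tendsto_atTop]
  intro ε hε
  -- On a window of length h the function g varies by at most ε/4; the +1 covers L = 0.
  set h : ℝ := ε / (4 * (L + 1)) with hh
  have hpos : 0 < h := by positivity
  have hLh : L * h ≤ ε / 4 := by
    rw [hh, mul_div_assoc', div_le_div_iff₀ (by positivity) (by positivity)]
    nlinarith
  -- Two errors of hε/8, divided by h, bound the slope of G over the window by ε/4.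
  obtain ⟨N, hN⟩ := (Metric.tendsto_atTop.1 hl) (h * ε / 8) (by positivity)
  refine ⟨max N 0, fun t ht => ?_⟩
  have ht0 : 0 ≤ t := le_trans (le_max_right _ _) ht
  have htN : N ≤ t := le_trans (le_max_left _ _) ht
  obtain ⟨ξ, hξ, hξe⟩ := exists_hasDerivAt_eq_slope G g (show t < t + h by linarith)
    (fun x hx => ((hG x (by have := hx.1; simp only [ge_iff_le]; linarith)).continuousWithinAt.mono
      (fun y hy => by have := hy.1; simp only [mem_Ici]; linarith)))
    (fun x hx => (hG x (by have := hx.1; simp only [ge_iff_le]; linarith)).hasDerivAt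
      (Ici_mem_nhds (by have := hx.1; linarith)))
  have h1 := hN t htN
  have h2 := hN (t + h) (by linarith)
  rw [Real.dist_eq] at h1 h2
  have h3 : |g ξ| ≤ ε / 4 := by
    rw [hξe, add_sub_cancel_left, abs_div, abs_of_pos hpos, div_le_iff₀ hpos]
    have : |G (t + h) - G t| ≤ |G (t + h) - l| + |G t - l| := by
      rw [abs_sub_comm (G t) l]; exact abs_sub_le _ _ _
    linarith
  have h4 := hg t ht0 ξ (by have := hξ.1; simp only [ge_iff_le]; linarith)
  have h5 : |t - ξ| ≤ h := by rw [abs_le]; constructor <;> linarith [hξ.1, hξ.2]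
  have h6 : L * |t - ξ| ≤ L * h := mul_le_mul_of_nonneg_left h5 hL
  rw [Real.dist_eq, sub_zero]
  have : |g t| ≤ |g t - g ξ| + |g ξ| := by
    simpa using abs_add_le (g t - g ξ) (g ξ)
  linarith

/-- A nondecreasing bounded function on `[0, ∞)` converges at infinity. -/
theorem exists_tendsto_of_monotoneOn_Ici {G : ℝ → ℝ} {B : ℝ} (hG : MonotoneOn G (Ici 0))
    (hB : ∀ t ≥ 0, G t ≤ B) : ∃ l, Tendsto G atTop (𝓝 l) := by
  have hmono : Monotone fun t => G (max t 0) := fun a b hab =>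
    hG (mem_Ici.2 (le_max_right _ _)) (mem_Ici.2 (le_max_right _ _)) (max_le_max_right 0 hab)
  refine ⟨_, (tendsto_atTop_ciSup hmono ⟨B, ?_⟩).congr' ?_⟩
  · rintro _ ⟨t, rfl⟩
    exact hB _ (le_max_right _ _)
  · filter_upwards [eventually_ge_atTop 0] with t ht
    simp [max_eq_left ht]

/-! ### First-order filters -/

/-- The response `∫₀ᵗ e^{-r(t-τ)} g(τ) dτ` of a first-order low-pass filter to `g`. -/
noncomputable def expFilter (r : ℝ) (g : ℝ → ℝ) (t : ℝ) : ℝ :=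
  ∫ τ in (0 : ℝ)..t, Real.exp (-(r * (t - τ))) * g τ

theorem expFilter_eq (r : ℝ) (g : ℝ → ℝ) (t : ℝ) :
    expFilter r g t = Real.exp (-(r * t)) * ∫ τ in (0 : ℝ)..t, Real.exp (r * τ) * g τ := by
  rw [expFilter, ← intervalIntegral.integral_const_mul]
  refine intervalIntegral.integral_congr fun τ _ => ?_
  rw [← mul_assoc, ← Real.exp_add]
  ring_nf

@[simp]
theorem expFilter_zero (r : ℝ) (g : ℝ → ℝ) : expFilter r g 0 = 0 := by simp [expFilter]

theorem hasDerivAt_expFilter (r : ℝ) {g : ℝ → ℝ} (hg : Continuous g) (t : ℝ) :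
    HasDerivAt (expFilter r g) (g t - r * expFilter r g t) t := by
  have hc : Continuous fun τ => Real.exp (r * τ) * g τ := by fun_prop
  have h1 := hc.integral_hasStrictDerivAt 0 t |>.hasDerivAt
  have h2 : HasDerivAt (fun t => Real.exp (-(r * t))) (Real.exp (-(r * t)) * (-r)) t := by
    simpa using (((hasDerivAt_id t).const_mul r).neg).exp
  have h3 := h2.mul h1
  rw [show expFilter r g = _ from funext (expFilter_eq r g)]
  refine h3.congr_deriv ?_
  have : Real.exp (-(r * t)) * Real.exp (r * t) = 1 := by rw [← Real.exp_add]; simp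
  rw [← mul_assoc, this]; ring

theorem continuous_expFilter_uncurry {g : ℝ → ℝ} (hg : Continuous g) :
    Continuous fun p : ℝ × ℝ => expFilter p.1 g p.2 := by
  unfold expFilter
  refine intervalIntegral.continuous_parametric_intervalIntegral_of_continuous ?_ continuous_snd
  simp only [Function.uncurry_def]
  fun_prop

theorem continuous_expFilter (r : ℝ) {g : ℝ → ℝ} (hg : Continuous g) :
    Continuous (expFilter r g) :=
  (continuous_expFilter_uncurry hg).comp (Continuous.prodMk_right r)

/-- Integration by parts, with no boundary term at 0 because X vanishes there. The right-hand side
is the derivative of the filtered X, so filtering commutes with differentiation. -/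
theorem expFilter_deriv (r : ℝ) {X v : ℝ → ℝ} (hv : Continuous v)
    (hX : ∀ t, HasDerivAt X (v t) t) (hX0 : X 0 = 0) (t : ℝ) :
    expFilter r v t = X t - r * expFilter r X t := by
  have hXc : Continuous X := continuous_iff_continuousAt.2 fun t => (hX t).continuousAt
  have h1 : ∀ τ ∈ uIcc 0 t, HasDerivAt (fun τ => Real.exp (-(r * (t - τ))) * X τ)
      (r * (Real.exp (-(r * (t - τ))) * X τ) + Real.exp (-(r * (t - τ))) * v τ) τ := by
    intro τ _
    have h2 : HasDerivAt (fun τ => Real.exp (-(r * (t - τ))))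
        (Real.exp (-(r * (t - τ))) * r) τ := by
      simpa using ((((hasDerivAt_id τ).const_sub t).const_mul r).neg).exp
    exact (h2.mul (hX τ)).congr_deriv (by ring)
  have h3 := intervalIntegral.integral_eq_sub_of_hasDerivAt h1
    (Continuous.intervalIntegrable (by fun_prop) _ _)
  rw [intervalIntegral.integral_add (Continuous.intervalIntegrable (by fun_prop) _ _)
    (Continuous.intervalIntegrable (by fun_prop) _ _), intervalIntegral.integral_const_mul] at h3
  simp only [sub_self, mul_zero, neg_zero, Real.exp_zero, one_mul, hX0, sub_zero] at h3
  simp only [expFilter]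
  linarith

/-- The kernel is at most 1 and has mass at most 1/r. The first bound serves small r, the second
large r. -/
theorem abs_expFilter_le {r T M : ℝ} (hr : 0 < r) {g : ℝ → ℝ}
    (hM : ∀ t ∈ Icc 0 T, |g t| ≤ M) {t : ℝ} (ht : t ∈ Icc 0 T) :
    |expFilter r g t| ≤ min (M * T) (M / r) := by
  have hM0 : 0 ≤ M := (abs_nonneg _).trans (hM t ht)
  refine le_min ?_ ?_
  · have := intervalIntegral.norm_integral_le_of_norm_le_const (a := 0) (b := t) (C := M)
      (f := fun τ => Real.exp (-(r * (t - τ))) * g τ) (fun τ hτ => by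
        rw [uIoc_of_le ht.1] at hτ
        rw [norm_mul, Real.norm_eq_abs, Real.norm_eq_abs, Real.abs_exp]
        have h1 := hM τ ⟨hτ.1.le, hτ.2.trans ht.2⟩
        have h2 : Real.exp (-(r * (t - τ))) ≤ 1 := by
          rw [Real.exp_le_one_iff]
          have := mul_nonneg hr.le (sub_nonneg.2 hτ.2)
          linarith
        calc _ ≤ 1 * M := mul_le_mul h2 h1 (abs_nonneg _) zero_le_one
          _ = M := one_mul M)
    rw [sub_zero, abs_of_nonneg ht.1] at this
    exact this.trans (mul_le_mul_of_nonneg_left ht.2 hM0)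
  · have hc : Continuous fun τ => Real.exp (-(r * (t - τ))) * M := by fun_prop
    have h1 : |expFilter r g t| ≤ ∫ τ in (0 : ℝ)..t, Real.exp (-(r * (t - τ))) * M := by
      rw [expFilter, ← Real.norm_eq_abs]
      refine intervalIntegral.norm_integral_le_of_norm_le ht.1 (ae_of_all _ fun τ hτ => ?_)
        (hc.intervalIntegrable _ _)
      rw [norm_mul, Real.norm_eq_abs, Real.norm_eq_abs, Real.abs_exp]
      exact mul_le_mul_of_nonneg_left (hM τ ⟨hτ.1.le, hτ.2.trans ht.2⟩) (Real.exp_pos _).le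
    have h2 : ∀ τ ∈ uIcc 0 t, HasDerivAt (fun τ => Real.exp (-(r * (t - τ))) * (M / r))
        (Real.exp (-(r * (t - τ))) * M) τ := by
      intro τ _
      have h2 : HasDerivAt (fun τ => Real.exp (-(r * (t - τ))))
          (Real.exp (-(r * (t - τ))) * r) τ := by
        simpa using ((((hasDerivAt_id τ).const_sub t).const_mul r).neg).exp
      exact (h2.mul_const (M / r)).congr_deriv (by field_simp)
    rw [intervalIntegral.integral_eq_sub_of_hasDerivAt h2 (hc.intervalIntegrable _ _)] at h1
    have h3 : 0 ≤ Real.exp (-(r * (t - 0))) * (M / r) := by positivity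
    simp only [sub_self, mul_zero, neg_zero, Real.exp_zero, one_mul] at h1
    linarith

/-! ### Diffusive representation of the kernel t^{-α} -/

/-- This is the dominating function for all integrals over r: α > 0 gives integrability of r^{α-1}
at 0, and α < 1 that of r^{α-2} at infinity. -/
theorem integrableOn_rpow_mul_min {α P Q : ℝ} (hα₀ : 0 < α) (hα₁ : α < 1) (hP : 0 ≤ P)
    (hQ : 0 ≤ Q) : IntegrableOn (fun r : ℝ => r ^ (α - 1) * min P (Q / r)) (Ioi 0) := by
  have hmeas : Measurable fun r : ℝ => r ^ (α - 1) * min P (Q / r) := by fun_prop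
  rw [← Ioc_union_Ioi_eq_Ioi zero_le_one]
  refine IntegrableOn.union ?_ ?_
  · have h := (intervalIntegral.intervalIntegrable_rpow' (a := 0) (b := 1)
      (show -1 < α - 1 by linarith)).1
    refine Integrable.mono' (h.mul_const P) hmeas.aestronglyMeasurable ?_
    filter_upwards [ae_restrict_mem measurableSet_Ioc] with r hr
    have hr0 := hr.1
    rw [Real.norm_of_nonneg (by positivity)]
    exact mul_le_mul_of_nonneg_left (min_le_left _ _) (by positivity)
  · have h := integrableOn_Ioi_rpow_of_lt (show α - 2 < -1 by linarith) zero_lt_one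
    refine Integrable.mono' (h.mul_const Q) hmeas.aestronglyMeasurable ?_
    filter_upwards [ae_restrict_mem measurableSet_Ioi] with r hr
    have hr0 : 0 < r := zero_lt_one.trans hr
    rw [Real.norm_of_nonneg (by positivity)]
    calc _ ≤ r ^ (α - 1) * (Q / r) :=
          mul_le_mul_of_nonneg_left (min_le_right _ _) (by positivity)
      _ = r ^ (α - 2) * Q := by
        rw [show α - 2 = α - 1 - 1 by ring, Real.rpow_sub_one hr0.ne' (α - 1)]; ring

/-- The superposition `∫₀^∞ r^{α-1} (∫₀ᵗ e^{-r(t-τ)} g(τ) dτ) dr` of low-pass filters. It equals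
`Γ(α)` times the convolution of `g` with `t ↦ t^{-α}` on `[0, t]`. -/
noncomputable def diffusiveIntegral (α : ℝ) (g : ℝ → ℝ) (t : ℝ) : ℝ :=
  ∫ r in Ioi (0 : ℝ), r ^ (α - 1) * expFilter r g t

theorem exists_abs_le_of_continuous {g : ℝ → ℝ} (hg : Continuous g) (T : ℝ) :
    ∃ M ≥ 0, ∀ t ∈ Icc 0 T, |g t| ≤ M := by
  obtain ⟨M, hM⟩ := isCompact_Icc.exists_bound_of_continuousOn (s := Icc 0 T) hg.continuousOn
  exact ⟨max M 0, le_max_right _ _, fun t ht => (hM t ht).trans (le_max_left _ _)⟩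

theorem abs_rpow_mul_expFilter_le {α r P Q t : ℝ} {g : ℝ → ℝ} (hr : 0 < r)
    (h : |expFilter r g t| ≤ min P (Q / r)) :
    ‖r ^ (α - 1) * expFilter r g t‖ ≤ r ^ (α - 1) * min P (Q / r) := by
  rw [norm_mul, Real.norm_of_nonneg (by positivity : 0 ≤ r ^ (α - 1))]
  exact mul_le_mul_of_nonneg_left h (by positivity)

theorem aestronglyMeasurable_rpow_mul_expFilter (α : ℝ) {g : ℝ → ℝ} (hg : Continuous g)
    (t : ℝ) (μ : Measure ℝ) :
    AEStronglyMeasurable (fun r => r ^ (α - 1) * expFilter r g t) μ := by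
  have h : Continuous fun r => expFilter r g t :=
    (continuous_expFilter_uncurry hg).comp (Continuous.prodMk_left t)
  exact (Measurable.mul (by fun_prop) h.measurable).aestronglyMeasurable

theorem continuousOn_diffusiveIntegral {α : ℝ} (hα₀ : 0 < α) (hα₁ : α < 1) {g : ℝ → ℝ}
    (hg : Continuous g) : ContinuousOn (diffusiveIntegral α g) (Ici 0) := by
  intro t ht
  obtain ⟨M, hM0, hM⟩ := exists_abs_le_of_continuous hg (t + 1)
  have ht' : 0 ≤ t := ht
  refine continuousWithinAt_of_dominated
    (bound := fun r => r ^ (α - 1) * min (M * (t + 1)) (M / r)) ?_ ?_ ?_ ?_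
  · exact Eventually.of_forall fun s => aestronglyMeasurable_rpow_mul_expFilter α hg s _
  · filter_upwards [self_mem_nhdsWithin,
      mem_nhdsWithin_of_mem_nhds (Iio_mem_nhds (show t < t + 1 by linarith))] with s hs0 hs1
    filter_upwards [ae_restrict_mem measurableSet_Ioi] with r hr
    exact abs_rpow_mul_expFilter_le hr (abs_expFilter_le hr hM ⟨hs0, le_of_lt hs1⟩)
  · exact integrableOn_rpow_mul_min hα₀ hα₁ (by positivity) hM0
  · exact ae_of_all _ fun r =>
      ((continuous_expFilter r hg).const_mul _).continuousAt.continuousWithinAt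

theorem abs_diffusiveIntegral_le {α P Q t : ℝ} (hα₀ : 0 < α) (hα₁ : α < 1) (hP : 0 ≤ P)
    (hQ : 0 ≤ Q) {g : ℝ → ℝ} (h : ∀ r > 0, |expFilter r g t| ≤ min P (Q / r)) :
    |diffusiveIntegral α g t| ≤ ∫ r in Ioi (0 : ℝ), r ^ (α - 1) * min P (Q / r) := by
  rw [diffusiveIntegral, ← Real.norm_eq_abs]
  refine norm_integral_le_of_norm_le (integrableOn_rpow_mul_min hα₀ hα₁ hP hQ) ?_
  filter_upwards [ae_restrict_mem measurableSet_Ioi] with r hr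
  exact abs_rpow_mul_expFilter_le hr (h r hr)

/-- Fubini's theorem for the diffusive integral tested against a continuous function. -/
theorem integrable_mul_rpow_mul_expFilter {α T : ℝ} (hα₀ : 0 < α) (hα₁ : α < 1) (hT : 0 ≤ T)
    {w g : ℝ → ℝ} (hw : Continuous w) (hg : Continuous g) :
    Integrable (Function.uncurry fun t r => w t * (r ^ (α - 1) * expFilter r g t))
      ((volume.restrict (uIoc 0 T)).prod (volume.restrict (Ioi 0))) := by
  obtain ⟨M, hM0, hM⟩ := exists_abs_le_of_continuous hg T
  obtain ⟨W, hW0, hW⟩ := exists_abs_le_of_continuous hw T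
  have hb : Integrable (fun p : ℝ × ℝ => W * (p.2 ^ (α - 1) * min (M * T) (M / p.2)))
      ((volume.restrict (uIoc 0 T)).prod (volume.restrict (Ioi 0))) :=
    Integrable.mul_prod (f := fun _ : ℝ => W)
      (g := fun r : ℝ => r ^ (α - 1) * min (M * T) (M / r))
      ((intervalIntegrable_const (a := 0) (b := T)).def')
      (integrableOn_rpow_mul_min hα₀ hα₁ (by positivity) hM0)
  refine hb.mono' ?_ ?_
  · have h1 : Measurable fun p : ℝ × ℝ => expFilter p.2 g p.1 :=
      ((continuous_expFilter_uncurry hg).comp continuous_swap).measurable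
    have h2 : Measurable fun p : ℝ × ℝ => w p.1 := hw.measurable.comp measurable_fst
    have h3 : Measurable fun p : ℝ × ℝ => p.2 ^ (α - 1) := by fun_prop
    exact (h2.mul (h3.mul h1)).aestronglyMeasurable
  · rw [Measure.prod_restrict]
    filter_upwards [ae_restrict_mem (measurableSet_uIoc.prod measurableSet_Ioi)] with p hp
    obtain ⟨h1, h2⟩ := hp
    rw [uIoc_of_le hT] at h1
    have h3 : p.1 ∈ Icc 0 T := Ioc_subset_Icc_self h1
    rw [Function.uncurry_def, norm_mul]
    exact mul_le_mul (hW _ h3)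
      (abs_rpow_mul_expFilter_le h2 (abs_expFilter_le h2 hM h3)) (norm_nonneg _) hW0

theorem integrableOn_rpow_mul_integral_mul_expFilter {α T : ℝ} (hα₀ : 0 < α) (hα₁ : α < 1)
    (hT : 0 ≤ T) {w g : ℝ → ℝ} (hw : Continuous w) (hg : Continuous g) :
    IntegrableOn (fun r => r ^ (α - 1) * ∫ t in (0 : ℝ)..T, w t * expFilter r g t) (Ioi 0) := by
  have h := (integrable_mul_rpow_mul_expFilter hα₀ hα₁ hT hw hg).integral_prod_right
  refine h.congr (ae_of_all _ fun r => ?_)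
  simp only
  rw [uIoc_of_le hT, ← intervalIntegral.integral_of_le hT, ← intervalIntegral.integral_const_mul]
  refine intervalIntegral.integral_congr fun t _ => ?_
  simp only [Function.uncurry_apply_pair]
  ring

theorem integral_mul_diffusiveIntegral {α T : ℝ} (hα₀ : 0 < α) (hα₁ : α < 1) (hT : 0 ≤ T)
    {w g : ℝ → ℝ} (hw : Continuous w) (hg : Continuous g) :
    ∫ t in (0 : ℝ)..T, w t * diffusiveIntegral α g t =
      ∫ r in Ioi (0 : ℝ), r ^ (α - 1) * ∫ t in (0 : ℝ)..T, w t * expFilter r g t := by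
  simp_rw [diffusiveIntegral, ← integral_const_mul]
  rw [intervalIntegral_integral_swap (integrable_mul_rpow_mul_expFilter hα₀ hα₁ hT hw hg)]
  refine integral_congr_ae (ae_of_all _ fun r => ?_)
  simp only
  rw [← intervalIntegral.integral_const_mul]
  refine intervalIntegral.integral_congr fun t _ => ?_
  ring

/-- After Fubini it suffices to integrate each filter, and the filtered v is the derivative of the
filtered X. This turns the time integral of the Caputo derivative into a memory term in the
displacement itself. -/
theorem integral_diffusiveIntegral {α T : ℝ} (hα₀ : 0 < α) (hα₁ : α < 1) (hT : 0 ≤ T)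
    {X v : ℝ → ℝ} (hv : Continuous v) (hX : ∀ t, HasDerivAt X (v t) t) (hX0 : X 0 = 0) :
    ∫ t in (0 : ℝ)..T, diffusiveIntegral α v t = diffusiveIntegral α X T := by
  have hXc : Continuous X := continuous_iff_continuousAt.2 fun t => (hX t).continuousAt
  have h := integral_mul_diffusiveIntegral hα₀ hα₁ hT (continuous_const (y := (1 : ℝ))) hv
  simp only [one_mul] at h
  rw [h, diffusiveIntegral]
  refine integral_congr_ae (ae_of_all _ fun r => ?_)
  have h1 : ∀ t ∈ uIcc 0 T, HasDerivAt (expFilter r X) (expFilter r v t) t := fun t _ => by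
    rw [expFilter_deriv r hv hX hX0]; exact hasDerivAt_expFilter r hXc t
  simp only
  rw [intervalIntegral.integral_eq_sub_of_hasDerivAt h1
    ((continuous_expFilter r hv).intervalIntegrable _ _), expFilter_zero, sub_zero]

/-- The diffusive representation of the convolution with the weakly singular kernel `t^{-α}`. -/
theorem integral_div_rpow_eq_diffusiveIntegral {α t : ℝ} (hα₀ : 0 < α) (hα₁ : α < 1)
    (ht : 0 ≤ t) {g : ℝ → ℝ} (hg : Continuous g) :
    ∫ τ in (0 : ℝ)..t, g τ / (t - τ) ^ α = (Real.Gamma α)⁻¹ * diffusiveIntegral α g t := by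
  have hΓ := Real.Gamma_pos_of_pos hα₀
  have hkey : ∀ τ < t, ∫ r in Ioi (0 : ℝ), r ^ (α - 1) * Real.exp (-(r * (t - τ))) =
      Real.Gamma α / (t - τ) ^ α := fun τ hτ => by
    have := Real.integral_rpow_mul_exp_neg_mul_Ioi hα₀ (sub_pos.2 hτ)
    simp_rw [mul_comm (t - τ)] at this
    rw [this, one_div, Real.inv_rpow (sub_pos.2 hτ).le]
    ring
  have hne : ∀ᵐ τ : ℝ ∂(volume.restrict (uIoc 0 t)), τ < t := by
    rw [uIoc_of_le ht, ← Measure.restrict_congr_set (Ioo_ae_eq_Ioc (a := 0) (b := t))]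
    filter_upwards [ae_restrict_mem measurableSet_Ioo] with τ hτ using hτ.2
  have hint : Integrable (Function.uncurry fun τ r =>
      g τ * (r ^ (α - 1) * Real.exp (-(r * (t - τ)))))
      ((volume.restrict (uIoc 0 t)).prod (volume.restrict (Ioi 0))) := by
    have hme : Measurable (Function.uncurry fun τ r =>
        g τ * (r ^ (α - 1) * Real.exp (-(r * (t - τ))))) := by
      have h2 : Measurable fun p : ℝ × ℝ => g p.1 := hg.measurable.comp measurable_fst
      exact h2.mul (by fun_prop)
    refine (integrable_prod_iff hme.aestronglyMeasurable).2 ⟨?_, ?_⟩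
    · filter_upwards [hne] with τ hτ
      have h0 : 0 < Real.Gamma α / (t - τ) ^ α :=
        div_pos hΓ (Real.rpow_pos_of_pos (sub_pos.2 hτ) _)
      rw [← hkey τ hτ] at h0
      -- A non-integrable function has Bochner integral zero, so the positive value of the Gamma
      -- integral already proves integrability in r.
      exact (Integrable.of_integral_ne_zero h0.ne').const_mul (g τ)
    · have h1 : IntervalIntegrable (fun τ : ℝ => (t - τ) ^ (-α)) volume 0 t := by
        have := (intervalIntegral.intervalIntegrable_rpow' (a := 0) (b := t)
          (show -1 < -α by linarith)).comp_sub_left t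
        simpa using this.symm
      have h2 : IntervalIntegrable (fun τ : ℝ => (t - τ) ^ (-α) * (Real.Gamma α * |g τ|))
          volume 0 t := h1.mul_continuousOn (by fun_prop)
      refine h2.def'.congr ?_
      filter_upwards [hne] with τ hτ
      have h3 : ∀ᵐ r : ℝ ∂(volume.restrict (Ioi 0)),
          ‖Function.uncurry (fun τ r => g τ * (r ^ (α - 1) * Real.exp (-(r * (t - τ))))) (τ, r)‖ =
            |g τ| * (r ^ (α - 1) * Real.exp (-(r * (t - τ)))) := by
        filter_upwards [ae_restrict_mem measurableSet_Ioi] with r hr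
        have hr' : 0 < r := hr
        rw [Function.uncurry_apply_pair, norm_mul, Real.norm_eq_abs,
          Real.norm_of_nonneg (by positivity)]
      rw [integral_congr_ae h3, integral_const_mul, hkey τ hτ,
        Real.rpow_neg (sub_pos.2 hτ).le]
      ring
  have hswap := intervalIntegral_integral_swap hint
  have hL : ∫ τ in (0 : ℝ)..t, ∫ r in Ioi (0 : ℝ),
      g τ * (r ^ (α - 1) * Real.exp (-(r * (t - τ)))) =
      Real.Gamma α * ∫ τ in (0 : ℝ)..t, g τ / (t - τ) ^ α := by
    rw [← intervalIntegral.integral_const_mul]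
    refine intervalIntegral.integral_congr_ae_restrict ?_
    filter_upwards [hne] with τ hτ
    rw [integral_const_mul, hkey τ hτ]
    ring
  have hR : ∫ r in Ioi (0 : ℝ), ∫ τ in (0 : ℝ)..t,
      g τ * (r ^ (α - 1) * Real.exp (-(r * (t - τ)))) = diffusiveIntegral α g t := by
    refine integral_congr_ae (ae_of_all _ fun r => ?_)
    simp only [expFilter]
    rw [← intervalIntegral.integral_const_mul]
    refine intervalIntegral.integral_congr fun t _ => ?_
    ring
  rw [hL, hR] at hswap
  rw [← hswap]
  field_simp

/-! ### Passivity and dissipation -/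

/-- Energy balance of one filter: multiply Z' = X - rZ by Z and integrate. -/
theorem integral_mul_expFilter (r T : ℝ) {X : ℝ → ℝ} (hX : Continuous X) :
    ∫ t in (0 : ℝ)..T, X t * expFilter r X t =
      expFilter r X T ^ 2 / 2 + r * ∫ t in (0 : ℝ)..T, expFilter r X t ^ 2 := by
  have hZ := continuous_expFilter r hX
  have h1 : ∀ t ∈ uIcc 0 T, HasDerivAt (fun t => expFilter r X t ^ 2 / 2)
      (X t * expFilter r X t - r * expFilter r X t ^ 2) t := fun t _ =>
    (((hasDerivAt_expFilter r hX t).pow 2).div_const 2).congr_deriv (by ring)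
  have h2 := intervalIntegral.integral_eq_sub_of_hasDerivAt h1
    (Continuous.intervalIntegrable (by fun_prop) _ _)
  rw [intervalIntegral.integral_sub (Continuous.intervalIntegrable (by fun_prop) _ _)
    (Continuous.intervalIntegrable (by fun_prop) _ _), intervalIntegral.integral_const_mul,
    expFilter_zero] at h2
  linarith

theorem mul_integral_sq_expFilter_le (r T : ℝ) {X : ℝ → ℝ} (hX : Continuous X) :
    r * ∫ t in (0 : ℝ)..T, expFilter r X t ^ 2 ≤ ∫ t in (0 : ℝ)..T, X t * expFilter r X t := by
  rw [integral_mul_expFilter r T hX]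
  linarith [sq_nonneg (expFilter r X T)]

theorem integral_mul_expFilter_nonneg {r T : ℝ} (hr : 0 ≤ r) (hT : 0 ≤ T) {X : ℝ → ℝ}
    (hX : Continuous X) : 0 ≤ ∫ t in (0 : ℝ)..T, X t * expFilter r X t :=
  (mul_nonneg hr (intervalIntegral.integral_nonneg hT fun _ _ => sq_nonneg _)).trans
    (mul_integral_sq_expFilter_le r T hX)

/-- The weakly singular kernel `t^{-α}` is positive definite. -/
theorem integral_mul_diffusiveIntegral_nonneg {α T : ℝ} (hα₀ : 0 < α) (hα₁ : α < 1)
    (hT : 0 ≤ T) {X : ℝ → ℝ} (hX : Continuous X) :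
    0 ≤ ∫ t in (0 : ℝ)..T, X t * diffusiveIntegral α X t := by
  rw [integral_mul_diffusiveIntegral hα₀ hα₁ hT hX hX]
  refine setIntegral_nonneg measurableSet_Ioi fun r hr => ?_
  have hr' : 0 < r := hr
  exact mul_nonneg (by positivity) (integral_mul_expFilter_nonneg hr'.le hT hX)

/-- Finite total dissipation makes some filtered signal square integrable. -/
theorem exists_integral_sq_expFilter_le {α C : ℝ} (hα₀ : 0 < α) (hα₁ : α < 1) {X : ℝ → ℝ}
    (hX : Continuous X)
    (hC : ∀ T ≥ 0, ∫ t in (0 : ℝ)..T, X t * diffusiveIntegral α X t ≤ C) :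
    ∃ r > 0, ∃ B, ∀ T ≥ 0, ∫ t in (0 : ℝ)..T, expFilter r X t ^ 2 ≤ B := by
  set φ : ℕ → ℝ → ℝ := fun n r => r ^ (α - 1) * ∫ t in (0 : ℝ)..n, X t * expFilter r X t with hφ
  have hmeas : ∀ n, Measurable fun r => ENNReal.ofReal (φ n r) := fun n => by
    have h1 : Continuous fun r => ∫ t in (0 : ℝ)..n, X t * expFilter r X t := by
      refine intervalIntegral.continuous_parametric_intervalIntegral_of_continuous' ?_ _ _
      exact (hX.comp continuous_snd).mul (continuous_expFilter_uncurry hX)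
    exact (Measurable.mul (by fun_prop) h1.measurable).ennreal_ofReal
  have hle : ∀ n, ∫⁻ r in Ioi (0 : ℝ), ENNReal.ofReal (φ n r) ≤ ENNReal.ofReal C := fun n => by
    rw [← ofReal_integral_eq_lintegral_ofReal
      (integrableOn_rpow_mul_integral_mul_expFilter hα₀ hα₁ n.cast_nonneg hX hX),
      ← integral_mul_diffusiveIntegral hα₀ hα₁ n.cast_nonneg hX hX]
    · exact ENNReal.ofReal_le_ofReal (hC n n.cast_nonneg)
    · filter_upwards [ae_restrict_mem measurableSet_Ioi] with r hr
      have hr' : 0 < r := hr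
      exact mul_nonneg (by positivity) (integral_mul_expFilter_nonneg hr'.le n.cast_nonneg hX)
  -- The term Z(n)²/2 means that `φ n r` need not be monotone in n, so Fatou's lemma takes the place
  -- of monotone convergence.
  have hfatou : ∫⁻ r in Ioi (0 : ℝ), liminf (fun n => ENNReal.ofReal (φ n r)) atTop < ⊤ := by
    refine (lintegral_liminf_le hmeas).trans_lt (lt_of_le_of_lt ?_ (ENNReal.ofReal_lt_top (r := C)))
    exact liminf_le_of_frequently_le' (Frequently.of_forall hle)
  have hae := ae_lt_top (Measurable.liminf hmeas) hfatou.ne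
  have : NeBot (ae (volume.restrict (Ioi (0 : ℝ)))) := by
    rw [ae_neBot, Ne, Measure.restrict_eq_zero, Real.volume_Ioi]
    exact ENNReal.top_ne_zero
  obtain ⟨r, hr, hr0⟩ := (hae.and (ae_restrict_mem measurableSet_Ioi)).exists
  have hr0' : 0 < r := hr0
  obtain ⟨K, hK, hKtop⟩ := exists_between hr
  have hfreq := frequently_lt_of_liminf_lt (by isBoundedDefault) hK
  have hpos : 0 < r ^ (α - 1) * r := by positivity
  refine ⟨r, hr0', K.toReal / (r ^ (α - 1) * r), fun T hT => ?_⟩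
  -- The liminf controls only infinitely many n; one beyond T is enough, because ∫Z² grows with the
  -- interval.
  obtain ⟨n, hn, hnK⟩ := (frequently_atTop.1 hfreq) ⌈T⌉₊
  have hTn : T ≤ n := (Nat.le_ceil T).trans (by exact_mod_cast hn)
  have hZ : Continuous fun t => expFilter r X t ^ 2 := (continuous_expFilter r hX).pow 2
  have h1 : ∫ t in (0 : ℝ)..T, expFilter r X t ^ 2 ≤ ∫ t in (0 : ℝ)..n, expFilter r X t ^ 2 :=
    intervalIntegral.integral_mono_interval le_rfl hT hTn (ae_of_all _ fun _ => sq_nonneg _)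
      (hZ.intervalIntegrable _ _)
  have h2 : φ n r ≤ K.toReal :=
    (ENNReal.ofReal_le_iff_le_toReal hKtop.ne).1 hnK.le
  have h3 : r ^ (α - 1) * (r * ∫ t in (0 : ℝ)..n, expFilter r X t ^ 2) ≤ φ n r :=
    mul_le_mul_of_nonneg_left (mul_integral_sq_expFilter_le r n hX) (by positivity)
  rw [le_div_iff₀ hpos]
  have h4 := mul_le_mul_of_nonneg_right h1 hpos.le
  linarith

/-! ### The fractional oscillator -/

/-- An absolutely integrable forcing keeps the energy of the oscillator, and the energy dissipated
by the fractional damper, bounded. -/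
theorem fractionalOscillator_energy_bound {α a b S : ℝ} (hα₀ : 0 < α) (hα₁ : α < 1) (ha : 0 < a)
    (hb : 0 < b) {v X Y s : ℝ → ℝ} (hv : Continuous v) (hX : ∀ t, HasDerivAt X (v t) t)
    (hY : ∀ t, HasDerivAt Y (X t) t) (hX0 : X 0 = 0) (hY0 : Y 0 = 0)
    (heq : ∀ t ≥ 0, v t = s t - a * Y t - b * diffusiveIntegral α X t)
    (hS : ∀ T ≥ 0, ∫ t in (0 : ℝ)..T, |s t| ≤ S) {T : ℝ} (hT : 0 ≤ T) :
    |X T| ≤ 2 * S ∧ a * Y T ^ 2 / 2 ≤ 2 * S ^ 2 ∧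
      b * ∫ t in (0 : ℝ)..T, X t * diffusiveIntegral α X t ≤ 2 * S ^ 2 := by
  have hXc : Continuous X := continuous_iff_continuousAt.2 fun t => (hX t).continuousAt
  have hYc : Continuous Y := continuous_iff_continuousAt.2 fun t => (hY t).continuousAt
  have hDc := continuousOn_diffusiveIntegral hα₀ hα₁ hXc
  have hsc : ContinuousOn s (Ici 0) :=
    ((hv.continuousOn.add (continuousOn_const.mul hYc.continuousOn)).add
      (continuousOn_const.mul hDc)).congr (f := fun t => v t + a * Y t + b * diffusiveIntegral α X t)
      fun t ht => by linarith [heq t ht]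
  have hsub : ∀ {T : ℝ}, 0 ≤ T → uIcc 0 T ⊆ Ici 0 := fun {T} hT => by
    rw [uIcc_of_le hT]; exact Icc_subset_Ici_self
  have hS0 : 0 ≤ S := by simpa using hS 0 le_rfl
  have henergy : ∀ T ≥ 0, X T ^ 2 / 2 + a * Y T ^ 2 / 2 +
      b * ∫ t in (0 : ℝ)..T, X t * diffusiveIntegral α X t = ∫ t in (0 : ℝ)..T, X t * s t := by
    intro T hT
    have h1 : IntervalIntegrable (fun t => X t * s t) volume 0 T :=
      (hXc.continuousOn.mul (hsc.mono (hsub hT))).intervalIntegrable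
    have h2 : IntervalIntegrable (fun t => X t * diffusiveIntegral α X t) volume 0 T :=
      (hXc.continuousOn.mul (hDc.mono (hsub hT))).intervalIntegrable
    have h3 : ∀ t ∈ uIcc 0 T, HasDerivAt (fun t => X t ^ 2 / 2 + a * Y t ^ 2 / 2)
        (X t * s t - b * (X t * diffusiveIntegral α X t)) t := fun t ht =>
      ((((hX t).pow 2).div_const 2).add ((((hY t).pow 2).const_mul a).div_const 2)).congr_deriv
        (by rw [heq t (hsub hT ht)]; ring)
    have h4 := intervalIntegral.integral_eq_sub_of_hasDerivAt h3 (h1.sub (h2.const_mul b))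
    rw [intervalIntegral.integral_sub h1 (h2.const_mul b), intervalIntegral.integral_const_mul,
      hX0, hY0] at h4
    linarith
  have hforce : ∀ M ≥ 0, (∀ t ∈ Icc 0 T, |X t| ≤ M) → ∀ t ∈ Icc 0 T,
      ∫ t in (0 : ℝ)..t, X t * s t ≤ M * S := fun M hM hXM t ht => by
    have h1 : IntervalIntegrable (fun t => X t * s t) volume 0 t :=
      (hXc.continuousOn.mul (hsc.mono (hsub ht.1))).intervalIntegrable
    have h2 : IntervalIntegrable (fun t => M * |s t|) volume 0 t :=
      (continuousOn_const.mul (hsc.mono (hsub ht.1)).abs).intervalIntegrable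
    refine (intervalIntegral.integral_mono_on ht.1 h1 h2 fun τ hτ => ?_).trans ?_
    · refine (le_abs_self _).trans ?_
      rw [abs_mul]
      exact mul_le_mul_of_nonneg_right (hXM τ ⟨hτ.1, hτ.2.trans ht.2⟩) (abs_nonneg _)
    · rw [intervalIntegral.integral_const_mul]
      exact mul_le_mul_of_nonneg_left (hS t ht.1) hM
  obtain ⟨t₀, ht₀, hmax⟩ := isCompact_Icc.exists_isMaxOn (nonempty_Icc.2 hT) hXc.abs.continuousOn
  have hXM : ∀ t ∈ Icc 0 T, |X t| ≤ |X t₀| := fun t ht => hmax ht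
  have hdiss : ∀ t ≥ 0, 0 ≤ b * ∫ t in (0 : ℝ)..t, X t * diffusiveIntegral α X t := fun t ht =>
    mul_nonneg hb.le (integral_mul_diffusiveIntegral_nonneg hα₀ hα₁ ht hXc)
  have hYn : ∀ t, 0 ≤ a * Y t ^ 2 / 2 := fun t => by positivity
  -- At the maximum point of |X| the energy balance gives |X|²/2 ≤ |X|·S.
  have hM : |X t₀| ≤ 2 * S := by
    have h1 := henergy t₀ ht₀.1
    have h2 := hforce _ (abs_nonneg _) hXM t₀ ht₀
    have h3 := hdiss t₀ ht₀.1
    have h4 := hYn t₀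
    have h5 := sq_abs (X t₀)
    by_contra hcon
    push Not at hcon
    nlinarith [abs_nonneg (X t₀)]
  have h1 := henergy T hT
  have h2 := hforce _ (abs_nonneg _) hXM T (right_mem_Icc.2 hT)
  have h3 := hdiss T hT
  have h4 := hYn T
  have h5 : |X t₀| * S ≤ 2 * S * S := mul_le_mul_of_nonneg_right hM hS0
  have h6 := sq_nonneg (X T)
  refine ⟨(hXM T (right_mem_Icc.2 hT)).trans hM, ?_, ?_⟩ <;> nlinarith

/-- The displacement of a fractional Kelvin-Voigt oscillator with bounded, absolutely integrable
forcing of the momentum balance tends to zero. -/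
theorem fractionalOscillator_tendsto_zero {α a b S S' : ℝ} (hα₀ : 0 < α) (hα₁ : α < 1)
    (ha : 0 < a) (hb : 0 < b) {v X Y s : ℝ → ℝ} (hv : Continuous v)
    (hX : ∀ t, HasDerivAt X (v t) t) (hY : ∀ t, HasDerivAt Y (X t) t) (hX0 : X 0 = 0)
    (hY0 : Y 0 = 0) (heq : ∀ t ≥ 0, v t = s t - a * Y t - b * diffusiveIntegral α X t)
    (hS : ∀ T ≥ 0, ∫ t in (0 : ℝ)..T, |s t| ≤ S) (hS' : ∀ t ≥ 0, |s t| ≤ S') :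
    Tendsto X atTop (𝓝 0) := by
  have hXc : Continuous X := continuous_iff_continuousAt.2 fun t => (hX t).continuousAt
  have hbd := fun T (hT : 0 ≤ T) =>
    fractionalOscillator_energy_bound hα₀ hα₁ ha hb hv hX hY hX0 hY0 heq hS hT
  obtain ⟨M, hM⟩ : ∃ M, ∀ t ≥ 0, |X t| ≤ M := ⟨2 * S, fun t ht => (hbd t ht).1⟩
  have hM0 : 0 ≤ M := (abs_nonneg _).trans (hM 0 le_rfl)
  obtain ⟨N, hN⟩ : ∃ N, ∀ t ≥ 0, |Y t| ≤ N := by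
    refine ⟨√(4 * S ^ 2 / a), fun t ht => Real.abs_le_sqrt ?_⟩
    rw [le_div_iff₀ ha]
    linarith [(hbd t ht).2.1]
  have hN0 : 0 ≤ N := (abs_nonneg _).trans (hN 0 le_rfl)
  have hZM : ∀ r > 0, ∀ t ≥ 0, |expFilter r X t| ≤ M / r := fun r hr t ht =>
    (abs_expFilter_le hr (fun s hs => hM s hs.1) ⟨ht, le_refl t⟩).trans (min_le_right _ _)
  -- The bound M/r alone is useless near r = 0. Since X = Y', the filtered X is Y - r·(filtered Y),
  -- bounded by N + N uniformly in r and t.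
  have hZN : ∀ r > 0, ∀ t ≥ 0, |expFilter r X t| ≤ 2 * N := fun r hr t ht => by
    rw [expFilter_deriv r hXc hY hY0 t]
    have h1 : |expFilter r Y t| ≤ N / r :=
      (abs_expFilter_le hr (fun s hs => hN s hs.1) ⟨ht, le_refl t⟩).trans (min_le_right _ _)
    have h2 : |r * expFilter r Y t| ≤ N := by
      rw [abs_mul, abs_of_pos hr]
      calc _ ≤ r * (N / r) := mul_le_mul_of_nonneg_left h1 hr.le
        _ = N := by field_simp
    have h3 := abs_sub (Y t) (r * expFilter r Y t)
    linarith [hN t ht]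
  obtain ⟨D, hD⟩ : ∃ D, ∀ t ≥ 0, |diffusiveIntegral α X t| ≤ D :=
    ⟨_, fun t ht => abs_diffusiveIntegral_le hα₀ hα₁ (by positivity) hM0
      fun r hr => le_min (hZN r hr t ht) (hZM r hr t ht)⟩
  have hvb : ∀ t ≥ 0, |v t| ≤ S' + a * N + b * D := fun t ht => by
    rw [heq t ht]
    have h1 := abs_sub (s t - a * Y t) (b * diffusiveIntegral α X t)
    have h2 := abs_sub (s t) (a * Y t)
    rw [abs_mul, abs_of_pos hb] at h1
    rw [abs_mul, abs_of_pos ha] at h2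
    have h3 := mul_le_mul_of_nonneg_left (hD t ht) hb.le
    have h4 := mul_le_mul_of_nonneg_left (hN t ht) ha.le
    linarith [hS' t ht]
  have hlip : ∀ {h h' : ℝ → ℝ} {C : ℝ}, (∀ t, HasDerivAt h (h' t) t) → (∀ t ≥ 0, |h' t| ≤ C) →
      ∀ x ≥ 0, ∀ y ≥ 0, |h x - h y| ≤ C * |x - y| := fun hh hC x hx y hy =>
    (convex_Ici (0 : ℝ)).norm_image_sub_le_of_norm_hasDerivWithin_le
      (fun t _ => (hh t).hasDerivWithinAt) (fun t ht => hC t ht) hy hx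
  obtain ⟨r, hr, B, hB⟩ := exists_integral_sq_expFilter_le hα₀ hα₁ (C := 2 * S ^ 2 / b) hXc
    fun T hT => by
      rw [le_div_iff₀ hb]
      linarith [(hbd T hT).2.2]
  set Z := expFilter r X with hZ
  have hZc : Continuous Z := continuous_expFilter r hXc
  have hZd : ∀ t, HasDerivAt Z (X t - r * Z t) t := hasDerivAt_expFilter r hXc
  have hZb : ∀ t ≥ 0, |Z t| ≤ M / r := hZM r hr
  have hZd_b : ∀ t ≥ 0, |X t - r * Z t| ≤ M + r * (M / r) := fun t ht => by
    have h1 := abs_sub (X t) (r * Z t)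
    rw [abs_mul, abs_of_pos hr] at h1
    linarith [hM t ht, mul_le_mul_of_nonneg_left (hZb t ht) hr.le]
  have hZ2 : Tendsto (fun t => Z t ^ 2) atTop (𝓝 0) := by
    have hI : ∀ t, HasDerivAt (fun t => ∫ τ in (0 : ℝ)..t, Z τ ^ 2) (Z t ^ 2) t := fun t =>
      ((hZc.pow 2).integral_hasStrictDerivAt 0 t).hasDerivAt
    obtain ⟨l, hl⟩ := exists_tendsto_of_monotoneOn_Ici (B := B)
      (G := fun t => ∫ τ in (0 : ℝ)..t, Z τ ^ 2)
      ((monotone_of_hasDerivAt_nonneg hI fun t => sq_nonneg _).monotoneOn _) hB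
    refine tendsto_zero_of_tendsto_of_lipschitz_deriv
      (L := 2 * (M / r) * (M + r * (M / r))) (fun t _ => (hI t).hasDerivWithinAt) ?_ hl
    refine hlip (h' := fun t => 2 * Z t * (X t - r * Z t))
      (fun t => ((hZd t).pow 2).congr_deriv (by ring)) fun t ht => ?_
    rw [abs_mul, abs_mul, abs_two]
    have := abs_nonneg (Z t)
    exact mul_le_mul (mul_le_mul_of_nonneg_left (hZb t ht) zero_le_two) (hZd_b t ht)
      (abs_nonneg _) (by positivity)
  have hZ0 : Tendsto Z atTop (𝓝 0) := by
    have := hZ2.sqrt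
    simp only [Real.sqrt_sq_eq_abs, Real.sqrt_zero] at this
    exact (tendsto_zero_iff_abs_tendsto_zero _).2 this
  have hZ' : Tendsto (fun t => X t - r * Z t) atTop (𝓝 0) := by
    refine tendsto_zero_of_tendsto_of_lipschitz_deriv
      (L := S' + a * N + b * D + r * (M + r * (M / r))) (fun t _ => (hZd t).hasDerivWithinAt) ?_ hZ0
    refine hlip (h' := fun t => v t - r * (X t - r * Z t))
      (fun t => (hX t).sub ((hZd t).const_mul r)) fun t ht => ?_
    have h1 := abs_sub (v t) (r * (X t - r * Z t))
    rw [abs_mul, abs_of_pos hr] at h1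
    linarith [hvb t ht, mul_le_mul_of_nonneg_left (hZd_b t ht) hr.le]
  simpa using hZ'.add (hZ0.const_mul r)

/-! ### Absolute continuity and extension to the whole line -/

/-- A locally absolutely continuous function with nonpositive derivative is nonincreasing. -/
theorem antitoneOn_of_absolutelyContinuous {V : ℝ → ℝ}
    (hV : ∀ T ≥ 0, AbsolutelyContinuousOnInterval V 0 T)
    (hd : ∀ᵐ t : ℝ, 0 < t → deriv V t ≤ 0) : AntitoneOn V (Ici 0) := by
  intro a ha b hb hab
  have ha' : 0 ≤ a := ha
  have hac : AbsolutelyContinuousOnInterval V a b := (hV b hb).mono (by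
    rw [uIcc_of_le hab, uIcc_of_le (ha'.trans hab)]; exact Icc_subset_Icc_left ha')
  have h1 := hac.integral_deriv_eq_sub
  have h2 : ∫ t in a..b, deriv V t ≤ ∫ t in a..b, (0 : ℝ) := by
    refine intervalIntegral.integral_mono_ae_restrict hab hac.intervalIntegrable_deriv
      intervalIntegrable_const ?_
    rw [← Measure.restrict_congr_set (Ioc_ae_eq_Icc (a := a) (b := b))]
    filter_upwards [ae_restrict_mem measurableSet_Ioc, ae_restrict_of_ae hd] with t ht hdt
    exact hdt (ha'.trans_lt ht.1)
  rw [intervalIntegral.integral_zero] at h2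
  linarith

/-- A locally absolutely continuous function with bounded derivative is Lipschitz. -/
theorem abs_sub_le_of_absolutelyContinuous {V : ℝ → ℝ} {B : ℝ}
    (hV : ∀ T ≥ 0, AbsolutelyContinuousOnInterval V 0 T)
    (hd : ∀ᵐ t : ℝ, 0 < t → |deriv V t| ≤ B) :
    ∀ a ≥ 0, ∀ b ≥ 0, |V a - V b| ≤ B * |a - b| := by
  have key : ∀ a ≥ 0, ∀ b, a ≤ b → |V b - V a| ≤ B * |b - a| := by
    intro a ha b hab
    have hac : AbsolutelyContinuousOnInterval V a b := (hV b (ha.trans hab)).mono (by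
      rw [uIcc_of_le hab, uIcc_of_le (ha.trans hab)]; exact Icc_subset_Icc_left ha)
    rw [← hac.integral_deriv_eq_sub, ← Real.norm_eq_abs]
    refine intervalIntegral.norm_integral_le_of_norm_le_const_ae ?_
    filter_upwards [hd] with t hdt ht
    rw [uIoc_of_le hab] at ht
    exact hdt (lt_of_le_of_lt ha ht.1)
  intro a ha b hb
  rcases le_total a b with h | h
  · rw [abs_sub_comm (V a), abs_sub_comm a]; exact key a ha b h
  · exact key b hb a h

/-- Freezing g at g(0) for negative times makes the whole-line lemmas applicable to data controlled
only on the half-line. -/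
theorem continuous_comp_max_zero {g : ℝ → ℝ} (hg : ContinuousOn g (Ici 0)) :
    Continuous fun t => g (max t 0) :=
  hg.comp_continuous (by fun_prop) fun t => mem_Ici.2 (le_max_right t 0)

theorem continuousOn_of_absolutelyContinuous {g : ℝ → ℝ}
    (hg : ∀ T ≥ 0, AbsolutelyContinuousOnInterval g 0 T) : ContinuousOn g (Ici 0) := by
  intro t ht
  have ht' : 0 ≤ t := ht
  have h := (hg (t + 1) (by positivity)).continuousOn t (by
    rw [uIcc_of_le (by positivity)]; exact ⟨ht', by linarith⟩)
  rw [uIcc_of_le (by positivity)] at h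
  refine h.mono_of_mem_nhdsWithin ?_
  rw [← Ici_inter_Iic]
  exact inter_mem_nhdsWithin _ (Iic_mem_nhds (by linarith))

theorem eq_integral_of_hasDerivWithinAt {x v : ℝ → ℝ} (hv : Continuous v)
    (hx : ∀ t ≥ 0, HasDerivWithinAt x (v t) (Ici 0) t) {t : ℝ} (ht : 0 ≤ t) :
    ∫ τ in (0 : ℝ)..t, v τ = x t - x 0 :=
  intervalIntegral.integral_eq_sub_of_hasDerivAt_of_le ht
    (fun τ hτ => ((hx τ hτ.1).continuousWithinAt).mono Icc_subset_Ici_self)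
    (fun τ hτ => (hx τ hτ.1.le).hasDerivAt (Ici_mem_nhds hτ.1)) (hv.intervalIntegrable _ _)

/-- The Caputo derivative of order in `(0, 1)` of a function with derivative `v` on `(0, ∞)`. -/
theorem caputoDeriv_eq_diffusiveIntegral {α : ℝ} (hα₀ : 0 < α) (hα₁ : α < 1) {x v : ℝ → ℝ}
    (hv : Continuous v) (hx : ∀ t > 0, HasDerivAt x (v t) t) {t : ℝ} (ht : 0 ≤ t) :
    caputoDeriv 0 α x t =
      (Real.Gamma (1 - α) * Real.Gamma α)⁻¹ * diffusiveIntegral α v t := by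
  have hceil : ⌈α⌉₊ = 1 := by
    rw [Nat.ceil_eq_iff one_ne_zero]; constructor <;> norm_num <;> linarith
  have h1 : ∫ τ in (0 : ℝ)..t, iteratedDeriv 1 x τ / (t - τ) ^ (α - (1 : ℕ) + 1) =
      ∫ τ in (0 : ℝ)..t, v τ / (t - τ) ^ α := by
    refine intervalIntegral.integral_congr_ae (ae_of_all _ fun τ hτ => ?_)
    rw [uIoc_of_le ht] at hτ
    rw [iteratedDeriv_one, (hx τ hτ.1).deriv, Nat.cast_one, sub_add_cancel]
  rw [caputoDeriv, hceil, h1, integral_div_rpow_eq_diffusiveIntegral hα₀ hα₁ ht hv, mul_inv,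
    Nat.cast_one]
  ring

theorem mul_eq_abs_of_mem_signSet {r σ : ℝ} (hσ : σ ∈ signSet r) : σ * r = |r| := by
  rcases lt_trichotomy r 0 with h | h | h
  · rw [hσ.2.1 h, abs_of_neg h]; ring
  · simp [h]
  · rw [hσ.1 h, abs_of_pos h]; ring

/-! ### The closed loop -/

theorem mainTheorem3
    (m c k α μ ρ₁ ρ₂ F : ℝ)
    (hm : 0 < m) (hc : 0 < c) (hk : 0 < k) (hα₀ : 0 < α) (hα₁ : α < 1)
    (hμ : 0 < μ) (hρ₁ : 0 < ρ₁) (hρ₂ : 0 < ρ₂)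
    (f u x₁ x₂ x₃ s Fhat : ℝ → ℝ)
    (hf : ∀ t ≥ 0, |f t| ≤ F)
    (hx : IsKelvinVoigtMotion m c k α f u x₁ x₂ x₃)
    (hs : s = slidingVariable m c k x₁ x₂ x₃)
    (hu : IsSwitchingControl ρ₁ ρ₂ s Fhat u)
    (hF : IsAdaptiveEstimate m μ s Fhat) :
    (∀ᵐ t : ℝ, 0 < t →
      HasDerivAt (adaptiveLyapunov μ F s Fhat)
        (1 / m * (f t * s t - (F + ρ₁ / √2) * |s t| - ρ₂ * s t ^ 2)) t) ∧
    (∀ᵐ t : ℝ, 0 < t →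
      deriv (adaptiveLyapunov μ F s Fhat) t ≤ 1 / m * (-(ρ₁ / √2) * |s t| - ρ₂ * s t ^ 2) ∧
      deriv (adaptiveLyapunov μ F s Fhat) t ≤ 0) ∧
    AntitoneOn (adaptiveLyapunov μ F s Fhat) (Ici 0) ∧
    Tendsto s atTop (𝓝 0) ∧
    Tendsto x₁ atTop (𝓝 0) := by
  obtain ⟨hzero, hvel, hfrac, hac, hmot⟩ := hx
  have hF0 : 0 ≤ F := (abs_nonneg _).trans (hf 0 le_rfl)
  -- Global continuous extensions of the state variables.
  set v : ℝ → ℝ := fun t => x₃ (max t 0) with hv_def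
  have hvx : ∀ t ≥ 0, v t = x₃ t := fun t ht => by simp [hv_def, max_eq_left ht]
  have hv : Continuous v := continuous_comp_max_zero (continuousOn_of_absolutelyContinuous hac)
  set X : ℝ → ℝ := fun t => ∫ τ in (0 : ℝ)..t, v τ with hX_def
  have hX : ∀ t, HasDerivAt X (v t) t := fun t => (hv.integral_hasStrictDerivAt 0 t).hasDerivAt
  have hX0 : X 0 = 0 := by simp [hX_def]
  have hXc : Continuous X := continuous_iff_continuousAt.2 fun t => (hX t).continuousAt
  have hvel' : ∀ t ≥ 0, HasDerivWithinAt x₁ (v t) (Ici 0) t := fun t ht => by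
    rw [hvx t ht]; exact hvel t ht
  have hXx : ∀ t ≥ 0, X t = x₁ t := fun t ht => by
    have := eq_integral_of_hasDerivWithinAt hv hvel' ht
    rw [hzero 0 le_rfl, sub_zero] at this
    exact this
  set Y : ℝ → ℝ := fun t => ∫ τ in (0 : ℝ)..t, X τ with hY_def
  have hY : ∀ t, HasDerivAt Y (X t) t := fun t => (hXc.integral_hasStrictDerivAt 0 t).hasDerivAt
  have hY0 : Y 0 = 0 := by simp [hY_def]
  set κ : ℝ := (Real.Gamma (1 - α) * Real.Gamma α)⁻¹ with hκ_def
  have hκ : 0 < κ := inv_pos.2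
    (mul_pos (Real.Gamma_pos_of_pos (by linarith)) (Real.Gamma_pos_of_pos hα₀))
  have hx₂ : ∀ t ≥ 0, x₂ t = κ * diffusiveIntegral α v t := fun t ht => by
    rw [hfrac t ht]
    exact caputoDeriv_eq_diffusiveIntegral hα₀ hα₁ hv
      (fun τ hτ => (hvel' τ (le_of_lt hτ)).hasDerivAt (Ici_mem_nhds hτ)) ht
  have hx₂c : ContinuousOn x₂ (Ici 0) :=
    (continuousOn_const.mul (continuousOn_diffusiveIntegral hα₀ hα₁ hv)).congr hx₂
  have hx₁c : ContinuousOn x₁ (Ici 0) := hXc.continuousOn.congr fun t ht => (hXx t ht).symm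
  have hsub : ∀ {T : ℝ}, 0 ≤ T → uIcc 0 T ⊆ Ici 0 := fun {T} hT => by
    rw [uIcc_of_le hT]; exact Icc_subset_Ici_self
  have hIx₁ : ∀ t ≥ 0, ∫ τ in (0 : ℝ)..t, x₁ τ = Y t := fun t ht =>
    intervalIntegral.integral_congr fun τ hτ => (hXx τ (hsub ht hτ)).symm
  have hIx₂ : ∀ t ≥ 0, ∫ τ in (0 : ℝ)..t, x₂ τ = κ * diffusiveIntegral α X t := fun t ht => by
    rw [← integral_diffusiveIntegral hα₀ hα₁ ht hv hX hX0, ← intervalIntegral.integral_const_mul]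
    exact intervalIntegral.integral_congr fun τ hτ => hx₂ τ (hsub ht hτ)
  -- Regularity and derivative of the sliding variable.
  have hs_ac : ∀ T ≥ 0, AbsolutelyContinuousOnInterval s 0 T := fun T hT => by
    have h1 : IntervalIntegrable x₁ volume 0 T := (hx₁c.mono (hsub hT)).intervalIntegrable
    have h2 : IntervalIntegrable x₂ volume 0 T := (hx₂c.mono (hsub hT)).intervalIntegrable
    rw [hs]
    exact ((hac T hT).add
      ((h1.absolutelyContinuousOnInterval_intervalIntegral left_mem_uIcc).const_mul (k / m))).add
      ((h2.absolutelyContinuousOnInterval_intervalIntegral left_mem_uIcc).const_mul (c / m))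
  have hsc : ContinuousOn s (Ici 0) := continuousOn_of_absolutelyContinuous hs_ac
  have hprim : ∀ {g : ℝ → ℝ}, ContinuousOn g (Ici 0) → ∀ t > 0,
      HasDerivAt (fun t => ∫ τ in (0 : ℝ)..t, g τ) (g t) t := fun {g} hg t ht => by
    have h1 := ((continuous_comp_max_zero hg).integral_hasStrictDerivAt 0 t).hasDerivAt
    simp only [max_eq_left (le_of_lt ht)] at h1
    refine h1.congr_of_eventuallyEq ?_
    filter_upwards [Ioi_mem_nhds ht] with y hy
    refine intervalIntegral.integral_congr fun τ hτ => ?_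
    have hτ0 : 0 ≤ τ := hsub (le_of_lt hy) hτ
    simp [max_eq_left hτ0]
  have hs_deriv : ∀ᵐ t : ℝ, 0 < t → HasDerivAt s (f t / m + u t / m) t := by
    filter_upwards [hmot] with t ht ht0
    rw [hs]
    exact (((ht ht0).add ((hprim hx₁c t ht0).const_mul (k / m))).add
      ((hprim hx₂c t ht0).const_mul (c / m))).congr_deriv (by ring)
  have hFh_ac : ∀ T ≥ 0, AbsolutelyContinuousOnInterval (fun t => Fhat t - F) 0 T := by
    intro T hT
    -- The adaptation rate is continuous, hence bounded on [0, T], so the estimate is Lipschitz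
    -- there.
    obtain ⟨C, hC⟩ := isCompact_Icc.exists_bound_of_continuousOn (s := Icc 0 T)
      (f := fun t => μ / m * |s t|)
      (continuousOn_const.mul (hsc.mono Icc_subset_Ici_self).abs)
    refine LipschitzOnWith.absolutelyContinuousOnInterval (K := C.toNNReal) ?_
    rw [uIcc_of_le hT]
    refine (convex_Icc 0 T).lipschitzOnWith_of_nnnorm_hasDerivWithin_le
      (f' := fun t => μ / m * |s t|)
      (fun t ht => ((hF t ht.1).mono Icc_subset_Ici_self).sub_const F) fun t ht => ?_
    rw [← NNReal.coe_le_coe, coe_nnnorm]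
    exact (hC t ht).trans (Real.le_coe_toNNReal C)
  have hV_ac : ∀ T ≥ 0, AbsolutelyContinuousOnInterval (adaptiveLyapunov μ F s Fhat) 0 T := by
    intro T hT
    have h := (((hs_ac T hT).mul (hs_ac T hT)).add
      (((hFh_ac T hT).mul (hFh_ac T hT)).const_mul (1 / μ))).const_mul (1 / 2)
    convert h using 1
    ext t
    simp only [adaptiveLyapunov, Pi.add_apply, Pi.mul_apply]
    ring
  have hV_deriv : ∀ᵐ t : ℝ, 0 < t → HasDerivAt (adaptiveLyapunov μ F s Fhat)
      (1 / m * (f t * s t - (F + ρ₁ / √2) * |s t| - ρ₂ * s t ^ 2)) t := by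
    filter_upwards [hs_deriv, hu] with t hst hut ht0
    obtain ⟨σ, hσ, huσ⟩ := hut ht0
    have hFt := (hF t ht0.le).hasDerivAt (Ici_mem_nhds ht0)
    refine ((((hst ht0).pow 2).add
      (((hFt.sub_const F).pow 2).const_mul (1 / μ))).const_mul (1 / 2)).congr_deriv ?_
    -- The choice of sign(0) is immaterial since σs = |s| always; the adaptation term (`Fhat` -
    -- F)|s|/m then cancels `Fhat` from the control.
    rw [huσ, ← mul_eq_abs_of_mem_signSet hσ]
    field_simp
    ring
  have hfs : ∀ t ≥ 0, f t * s t ≤ F * |s t| := fun t ht =>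
    (le_abs_self _).trans (by rw [abs_mul]; exact mul_le_mul_of_nonneg_right (hf t ht) (abs_nonneg _))
  have hV_le : ∀ᵐ t : ℝ, 0 < t →
      deriv (adaptiveLyapunov μ F s Fhat) t ≤ 1 / m * (-(ρ₁ / √2) * |s t| - ρ₂ * s t ^ 2) ∧
      deriv (adaptiveLyapunov μ F s Fhat) t ≤ 0 := by
    filter_upwards [hV_deriv] with t hVt ht0
    rw [(hVt ht0).deriv]
    have h1 : 1 / m * (f t * s t - (F + ρ₁ / √2) * |s t| - ρ₂ * s t ^ 2) ≤
        1 / m * (-(ρ₁ / √2) * |s t| - ρ₂ * s t ^ 2) :=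
      mul_le_mul_of_nonneg_left (by linarith [hfs t ht0.le]) (by positivity)
    have h2 : 0 ≤ 1 / m * (ρ₁ / √2 * |s t| + ρ₂ * s t ^ 2) := by positivity
    exact ⟨h1, by linarith⟩
  have hV_anti : AntitoneOn (adaptiveLyapunov μ F s Fhat) (Ici 0) :=
    antitoneOn_of_absolutelyContinuous hV_ac
      (hV_le.mono fun t ht ht0 => (ht ht0).2)
  -- Boundedness of the sliding variable and of the estimate.
  set V₀ := adaptiveLyapunov μ F s Fhat 0
  have hVb : ∀ t ≥ 0, 1 / 2 * (s t ^ 2 + 1 / μ * (Fhat t - F) ^ 2) ≤ V₀ := fun t ht =>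
    hV_anti (mem_Ici.2 le_rfl) ht ht
  have hsb : ∀ t ≥ 0, |s t| ≤ √(2 * V₀) := fun t ht => Real.abs_le_sqrt (by
    have h1 : 0 ≤ 1 / μ * (Fhat t - F) ^ 2 := by positivity
    linarith [hVb t ht])
  have hFb : ∀ t ≥ 0, |Fhat t - F| ≤ √(2 * V₀ * μ) := fun t ht => Real.abs_le_sqrt (by
    have h1 : 1 / μ * (Fhat t - F) ^ 2 ≤ 2 * V₀ := by linarith [hVb t ht, sq_nonneg (s t)]
    rwa [one_div, inv_mul_le_iff₀ hμ, mul_comm] at h1)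
  have hFhat : ∀ t ≥ 0, ∫ τ in (0 : ℝ)..t, |s τ| = m / μ * (Fhat t - Fhat 0) := fun t ht => by
    have h1 := intervalIntegral.integral_eq_sub_of_hasDerivAt_of_le ht
      (f := Fhat) (f' := fun τ => μ / m * |s τ|)
      (fun τ hτ => ((hF τ hτ.1).continuousWithinAt).mono Icc_subset_Ici_self)
      (fun τ hτ => (hF τ hτ.1.le).hasDerivAt (Ici_mem_nhds hτ.1))
      (continuousOn_const.mul (hsc.mono (hsub ht)).abs).intervalIntegrable
    rw [intervalIntegral.integral_const_mul] at h1
    rw [← h1]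
    field_simp
  -- By the adaptation law the L¹ norm of s is a multiple of the growth of `Fhat`, which is at most
  -- twice the bound on |`Fhat` - F|.
  have hsI : ∀ T ≥ 0, ∫ t in (0 : ℝ)..T, |s t| ≤ m / μ * (2 * √(2 * V₀ * μ)) := fun T hT => by
    rw [hFhat T hT]
    refine mul_le_mul_of_nonneg_left ?_ (by positivity)
    linarith [(abs_le.1 (hFb T hT)).2, (abs_le.1 (hFb 0 le_rfl)).1]
  -- The sliding variable is Lipschitz, so Barbalat's lemma applies to the estimate.
  set B : ℝ := (F + (F + √(2 * V₀ * μ) + ρ₁ / √2 + ρ₂ * √(2 * V₀))) / m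
  have hs_lip : ∀ a ≥ 0, ∀ b ≥ 0, |s a - s b| ≤ B * |a - b| := by
    refine abs_sub_le_of_absolutelyContinuous hs_ac ?_
    filter_upwards [hs_deriv, hu] with t hst hut ht0
    obtain ⟨σ, hσ, huσ⟩ := hut ht0
    rw [(hst ht0).deriv, ← add_div, abs_div, abs_of_pos hm]
    refine div_le_div_of_nonneg_right ?_ hm.le
    have hub : |u t| ≤ F + √(2 * V₀ * μ) + ρ₁ / √2 + ρ₂ * √(2 * V₀) := by
      rw [huσ]
      refine (abs_sub _ _).trans (add_le_add ?_ ?_)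
      · rw [abs_mul, abs_neg]
        have h1 : |Fhat t + ρ₁ / √2| ≤ F + √(2 * V₀ * μ) + ρ₁ / √2 := by
          have h0 : 0 ≤ ρ₁ / √2 := by positivity
          have h2 := abs_le.1 (hFb t ht0.le)
          rw [abs_le]; constructor <;> linarith
        calc _ ≤ |Fhat t + ρ₁ / √2| * 1 := mul_le_mul_of_nonneg_left hσ.2.2 (abs_nonneg _)
          _ ≤ _ := by rwa [mul_one]
      · rw [abs_mul, abs_of_pos hρ₂]
        exact mul_le_mul_of_nonneg_left (hsb t ht0.le) hρ₂.le
    exact (abs_add_le _ _).trans (add_le_add (hf t ht0.le) hub)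
  have hs0 : Tendsto s atTop (𝓝 0) := by
    have hmono : MonotoneOn Fhat (Ici 0) := by
      refine monotoneOn_of_hasDerivWithinAt_nonneg (convex_Ici 0)
        (f' := fun t => μ / m * |s t|) (fun t ht => (hF t ht).continuousWithinAt)
        (fun t ht => ?_) fun t _ => by positivity
      exact (hF t (interior_subset ht)).mono interior_subset
    obtain ⟨l, hl⟩ := exists_tendsto_of_monotoneOn_Ici (B := F + √(2 * V₀ * μ)) hmono
      fun t ht => by linarith [(abs_le.1 (hFb t ht)).2]
    have h1 := tendsto_zero_of_tendsto_of_lipschitz_deriv (L := μ / m * B) hF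
      (fun a ha b hb => by
        rw [← mul_sub, abs_mul, abs_of_pos (div_pos hμ hm), mul_assoc]
        exact mul_le_mul_of_nonneg_left ((abs_abs_sub_abs_le _ _).trans (hs_lip a ha b hb))
          (by positivity)) hl
    have h2 := h1.const_mul (m / μ)
    rw [mul_zero] at h2
    refine (tendsto_zero_iff_abs_tendsto_zero _).2 (h2.congr fun t => ?_)
    simp only [Function.comp_apply]
    field_simp
  refine ⟨hV_deriv, hV_le, hV_anti, hs0, ?_⟩
  have hXlim : Tendsto X atTop (𝓝 0) := by
    -- The definition of s, solved for the velocity, is the oscillator equation with a = k/m and b =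
    -- (c/m)κ.
    refine fractionalOscillator_tendsto_zero hα₀ hα₁ (div_pos hk hm)
      (mul_pos (div_pos hc hm) hκ) hv hX hY hX0 hY0 (fun t ht => ?_) hsI hsb
    rw [hs, slidingVariable, hIx₁ t ht, hIx₂ t ht, hvx t ht]
    ring
  refine hXlim.congr' ?_
  filter_upwards [eventually_ge_atTop 0] with t ht using hXx t ht
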